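/- \textbf{Conventions.} A (finite) graph $G$ consists of finite sets $V_G$ of vertices and $E^{\mathrm{dir}}_G$ of directed edges, maps $h_G,t_G\colon E^{\mathrm{dir}}_G\to V_G$ (heads and tails), and an involution $\iota_G$ of $E^{\mathrm{dir}}_G$ with $t_G\iota_G=h_G$; multiple edges, whole-loops, and half-loops (fixed points of $\iota_G$) are allowed. The edge set $E_G$ is the set of $\iota_G$-orbits, and the order of $G$ is $\mathrm{ord}(G)=\#E_G-\#V_G$. A subgraph is given by subsets of $V_G$ and $E^{\mathrm{dir}}_G$ closed under $h_G,t_G,\iota_G$. The Hashimoto matrix $H_G$ is indexed by $E^{\mathrm{dir}}_G$; its $(e_1,e_2)$ entry is $1$ if $h_G(e_1)=t_G(e_2)$ and $\iota_G(e_1)\neq e_2$, and $0$ otherwise. Let $\mu_1(G)$ be the Perron--Frobenius eigenvalue (spectral radius) of $H_G$, with $\mu_1(G)=0$ if $G$ has no edges. For $\nu\in\mathbb R$ and $r\in\mathbb Z$, a $(\ge\nu,<r)$-tangle is a connected graph $\psi$ with $\mu_1(\psi)\ge\nu$ and $\mathrm{ord}(\psi)<r$; it is minimal if no proper subgraph of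 $\psi$ is a $(\ge\nu,<r)$-tangle. $\mathrm{HasTangles}(\ge\nu,<r)$ is the class of graphs that contain a $(\ge\nu,<r)$-tangle as a subgraph, and $\mathrm{TangleFree}(\ge\nu,<r)$ is the class of those that do not. A graph is positive if every vertex has degree at least $2$ (a whole-loop contributes $2$ to the degree, a half-loop $1$) and every connected component has positive order. For a class $\mathcal T$ of graphs, $\mathrm{Meets}(\mathcal T)$ is the class of graphs with a non-empty subgraph isomorphic to an element of $\mathcal T$, and $\mathrm{Avoids}(\mathcal T)$ is the class of all other graphs; $\mathcal T$ is finitely positively generated if $\mathrm{Meets}(\mathcal T)=\mathrm{Meets}(\mathcal T')$ for some finite set $\mathcal T'$ of positive graphs. \textbf{Theorem.} Let $\nu>1$ be a real number and $r$ an integer. Then: \begin{enumerate} \item there are only finitely many isomorphism classes of minimal $(\ge\nu,<r)$-tangles; \item $\mathrm{HasTangles}(\ge\nu,<r)$ is finitely positively generated; \item there is a finite set $\mathcal T'$ of positive graphs with $\mathrm{TangleFree}(\ge\nu,<r)=\mathrm{Avoids}(\mathcal T')$. \end{enumerate} -/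

import Mathlib

universe u

/-- A finite graph with multiple edges, whole-loops and half-loops: a finite digraph
`(V, Edir, head, tail)` with an involution `inv` of its directed edges such that
`tail ∘ inv = head`.  A fixed point of `inv` is a half-loop. -/
structure FinGraph where
  V : Type u
  Edir : Type u
  finite_V : Finite V
  finite_Edir : Finite Edir
  head : Edir → V
  tail : Edir → V
  inv : Edir → Edir
  inv_inv : ∀ e, inv (inv e) = e
  tail_inv : ∀ e, tail (inv e) = head e

namespace FinGraph

attribute [instance] FinGraph.finite_V FinGraph.finite_Edir

theorem head_inv (G : FinGraph.{u}) (e : G.Edir) : G.head (G.inv e) = G.tail e := by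
  rw [← G.tail_inv, G.inv_inv]

/-- An isomorphism of graphs: bijections on vertices and on directed edges that intertwine
heads, tails and involutions. -/
structure Iso (G H : FinGraph.{u}) where
  onV : G.V ≃ H.V
  onE : G.Edir ≃ H.Edir
  map_head : ∀ e, H.head (onE e) = onV (G.head e)
  map_tail : ∀ e, H.tail (onE e) = onV (G.tail e)
  map_inv : ∀ e, H.inv (onE e) = onE (G.inv e)

/-- The relation of being isomorphic. -/
instance isoSetoid : Setoid FinGraph.{u} where
  r G H := Nonempty (Iso G H)
  iseqv := by
    refine ⟨fun G => ⟨⟨Equiv.refl _, Equiv.refl _, fun _ => rfl, fun _ => rfl, fun _ => rfl⟩⟩, ?_, ?_⟩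
    · rintro G H ⟨f⟩
      refine ⟨⟨f.onV.symm, f.onE.symm, fun e => ?_, fun e => ?_, fun e => ?_⟩⟩
      · rw [Equiv.eq_symm_apply, ← f.map_head, Equiv.apply_symm_apply]
      · rw [Equiv.eq_symm_apply, ← f.map_tail, Equiv.apply_symm_apply]
      · rw [Equiv.eq_symm_apply, ← f.map_inv, Equiv.apply_symm_apply]
    · rintro G H K ⟨f⟩ ⟨g⟩
      refine ⟨⟨f.onV.trans g.onV, f.onE.trans g.onE, fun e => ?_, fun e => ?_, fun e => ?_⟩⟩
      · simp [g.map_head, f.map_head]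
      · simp [g.map_tail, f.map_tail]
      · simp [g.map_inv, f.map_inv]

/-- Isomorphism classes of finite graphs. -/
abbrev IsoClass : Type (u + 1) := Quotient isoSetoid.{u}

/-- A subgraph: a set of vertices and a set of directed edges, the latter closed under the
involution, containing the endpoints of all its edges. -/
structure Subgraph (G : FinGraph.{u}) where
  verts : Set G.V
  edges : Set G.Edir
  head_mem : ∀ e ∈ edges, G.head e ∈ verts
  inv_mem : ∀ e ∈ edges, G.inv e ∈ edges

theorem Subgraph.tail_mem {G : FinGraph.{u}} (S : G.Subgraph) (e : G.Edir) (he : e ∈ S.edges) :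
    G.tail e ∈ S.verts := by
  rw [← G.head_inv]
  exact S.head_mem _ (S.inv_mem e he)

/-- A subgraph regarded as a graph in its own right. -/
def Subgraph.toGraph {G : FinGraph.{u}} (S : G.Subgraph) : FinGraph.{u} where
  V := S.verts
  Edir := S.edges
  finite_V := inferInstance
  finite_Edir := inferInstance
  head e := ⟨G.head e.1, S.head_mem e.1 e.2⟩
  tail e := ⟨G.tail e.1, S.tail_mem e.1 e.2⟩
  inv e := ⟨G.inv e.1, S.inv_mem e.1 e.2⟩
  inv_inv e := Subtype.ext (G.inv_inv e.1)
  tail_inv e := Subtype.ext (G.tail_inv e.1)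

/-- A subgraph is proper if it omits a vertex or a directed edge. -/
def Subgraph.IsProper {G : FinGraph.{u}} (S : G.Subgraph) : Prop :=
  S.verts ≠ Set.univ ∨ S.edges ≠ Set.univ

/-- Two directed edges are equivalent if they lie in the same orbit of the involution. -/
def edgeSetoid (G : FinGraph.{u}) : Setoid G.Edir where
  r e e' := e' = e ∨ e' = G.inv e
  iseqv := by
    refine ⟨fun e => Or.inl rfl, ?_, ?_⟩
    · rintro e e' (rfl | rfl)
      · exact Or.inl rfl
      · exact Or.inr (G.inv_inv e).symm
    · rintro e e' e'' (rfl | rfl) (rfl | rfl)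
      · exact Or.inl rfl
      · exact Or.inr rfl
      · exact Or.inr rfl
      · exact Or.inl (G.inv_inv e)

/-- The edge set: the set of orbits of the involution. -/
abbrev Edge (G : FinGraph.{u}) : Type u := Quotient G.edgeSetoid

/-- The order `#E - #V`. -/
noncomputable def ord (G : FinGraph.{u}) : ℤ := (Nat.card G.Edge : ℤ) - (Nat.card G.V : ℤ)

/-- The degree of a vertex: a whole-loop contributes `2` and a half-loop contributes `1`. -/
noncomputable def degree (G : FinGraph.{u}) (v : G.V) : ℕ := Nat.card {e : G.Edir // G.head e = v}

/-- `w` can be reached from `v` by a walk. -/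
def Reachable (G : FinGraph.{u}) : G.V → G.V → Prop :=
  Relation.ReflTransGen fun v w => ∃ e : G.Edir, G.tail e = v ∧ G.head e = w

/-- A graph is connected if it is non-empty and any two vertices are joined by a walk. -/
def Connected (G : FinGraph.{u}) : Prop :=
  Nonempty G.V ∧ ∀ v w : G.V, G.Reachable v w

/-- The connected component of a vertex, as a subgraph. -/
def component (G : FinGraph.{u}) (v : G.V) : G.Subgraph where
  verts := {w | G.Reachable v w}
  edges := {e | G.Reachable v (G.tail e)}
  head_mem e he := Relation.ReflTransGen.tail he ⟨e, rfl, rfl⟩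
  inv_mem e he := by
    change G.Reachable v (G.tail (G.inv e))
    rw [G.tail_inv]
    exact Relation.ReflTransGen.tail he ⟨e, rfl, rfl⟩

/-- A graph is pruned if each of its vertices has degree at least two. -/
def Pruned (G : FinGraph.{u}) : Prop := ∀ v : G.V, 2 ≤ G.degree v

/-- A graph is positive if it is pruned and each of its connected components has positive
order. -/
def Positive (G : FinGraph.{u}) : Prop :=
  G.Pruned ∧ ∀ v : G.V, 0 < (G.component v).toGraph.ord

noncomputable instance fintypeEdir (G : FinGraph.{u}) : Fintype G.Edir := Fintype.ofFinite _

noncomputable instance decidableEqEdir (G : FinGraph.{u}) : DecidableEq G.Edir :=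
  Classical.decEq _

open Classical in
/-- The Hashimoto (non-backtracking) matrix: the `(e₁, e₂)` entry is `1` if `e₁, e₂` are the
directed edges of a non-backtracking walk of length two, and `0` otherwise. -/
noncomputable def hashimoto (G : FinGraph.{u}) : Matrix G.Edir G.Edir ℂ :=
  Matrix.of fun e₁ e₂ => if G.head e₁ = G.tail e₂ ∧ G.inv e₁ ≠ e₂ then 1 else 0

/-- The Perron–Frobenius eigenvalue of the Hashimoto matrix, i.e. its spectral radius (the
largest modulus of an eigenvalue; it is `0` for a graph without edges). The spectrum of a matrix
is finite, so the conversion to a real number loses nothing. -/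
noncomputable def mu₁ (G : FinGraph.{u}) : ℝ := (spectralRadius ℂ G.hashimoto).toReal

/-- A `(≥ ν, < r)`-tangle. -/
def IsTangle (ν : ℝ) (r : ℤ) (ψ : FinGraph.{u}) : Prop :=
  ψ.Connected ∧ ν ≤ ψ.mu₁ ∧ ψ.ord < r

/-- A minimal `(≥ ν, < r)`-tangle: no proper subgraph is a `(≥ ν, < r)`-tangle. -/
def IsMinimalTangle (ν : ℝ) (r : ℤ) (ψ : FinGraph.{u}) : Prop :=
  IsTangle ν r ψ ∧ ∀ S : ψ.Subgraph, S.IsProper → ¬ IsTangle ν r S.toGraph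

/-- The graphs that contain a `(≥ ν, < r)`-tangle as a subgraph. -/
def HasTangles (ν : ℝ) (r : ℤ) : Set FinGraph.{u} :=
  {G | ∃ S : G.Subgraph, IsTangle ν r S.toGraph}

/-- The graphs that contain no `(≥ ν, < r)`-tangle as a subgraph. -/
def TangleFree (ν : ℝ) (r : ℤ) : Set FinGraph.{u} :=
  {G | ∀ S : G.Subgraph, ¬ IsTangle ν r S.toGraph}

/-- The graphs with a non-empty subgraph isomorphic to an element of the class `T`. -/
def Meets (T : Set FinGraph.{u}) : Set FinGraph.{u} :=
  {G | ∃ S : G.Subgraph, S.verts.Nonempty ∧ ∃ ψ ∈ T, Nonempty (Iso S.toGraph ψ)}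

/-- The graphs that do not meet the class `T`. -/
def Avoids (T : Set FinGraph.{u}) : Set FinGraph.{u} := (Meets T)ᶜ

/-- A class `T` is finitely positively generated if `Meets T = Meets T'` for a finite set `T'`
of positive graphs. -/
def FinitelyPositivelyGenerated (T : Set FinGraph.{u}) : Prop :=
  ∃ T' : Set FinGraph.{u}, T'.Finite ∧ (∀ ψ ∈ T', ψ.Positive) ∧ Meets T = Meets T'

end FinGraph

/-!
A positive vector `x` on the directed edges with `∑ x e' < ν * x e`, the sum over the edges `e'`
that follow `e`, exists if and only if the Perron–Frobenius eigenvalue is smaller than `ν`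
(`FinGraph.mu₁_lt_iff`). Comparisons of `mu₁` are reduced to the construction of such weights.

Let `ψ` be a minimal `(≥ ν, < r)`-tangle. Deleting edges from `ψ` makes `mu₁` smaller than `ν`
(`FinGraph.IsMinimalTangle.mu₁_lt`): otherwise a component of what remains would be a smaller
tangle, because `mu₁` is attained on a component and a connected subgraph of a connected graph has
no larger order. As an edge at a vertex of degree one does not affect `mu₁`, each vertex has degree
at least two, and as `ν > 1`, some vertex has degree at least three. Thus `ψ` is positive.

It remains to bound the size of `ψ`. Since `∑ (deg v - 2) ≤ 2 * ord ψ`, there are at most `6 * r`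
directed edges with a head of degree at least three (the branching edges), and the other edges are
arranged in at most as many chains through vertices of degree two. Let `S` be a subgraph of `ψ`
that is a union of chains and satisfies `mu₁ < ν`. If the chains outside `S` are long, then
`mu₁ ψ < ν` (`FinGraph.exists_mu₁_lt_of_long_chains`): weights on `S` extend to a long chain by a
geometric progression with a ratio between `1` and `ν`, which starts below the slack in the
inequalities on `S` and ends above the total weight of the edges that follow the chain. How long is
long enough depends on the size of `S` alone, there being finitely many matrices with entries `0`
and `1` of a given size. Hence a minimal tangle cannot have a large gap between the lengths of its
short chains and those of its long chains, and a pigeonhole argument bounds the lengths of all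
chains (`FinGraph.exists_card_edir_le`).

Finally, every tangle contains a minimal tangle, so that representatives of the finitely many
isomorphism classes of minimal tangles generate `HasTangles ν r`.
-/

/-! ### Positive subinvariant vectors of nonnegative matrices -/

section Spectral

variable {ι : Type*} [Fintype ι] [DecidableEq ι]

attribute [local instance] Matrix.linftyOpNormedAddCommGroup Matrix.linftyOpNormedRing
  Matrix.linftyOpNormedAlgebra

theorem spectralRadius_lt_top_of_matrix (A : Matrix ι ι ℂ) : spectralRadius ℂ A < ⊤ := by
  cases isEmpty_or_nonempty ι
  · simp [spectralRadius, spectrum.of_subsingleton]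
  · exact (spectrum.spectralRadius_le_nnnorm A).trans_lt ENNReal.coe_lt_top

/-- An eigenvector `v` is compared with the subinvariant vector `x` at an index where
`‖v i‖ / x i` is maximal. -/
theorem spectralRadius_lt_of_subinvariant (A : Matrix ι ι ℝ) (hA : ∀ i j, 0 ≤ A i j) {ν : ℝ}
    (hν : 0 < ν) (x : ι → ℝ) (hx : ∀ i, 0 < x i) (h : ∀ i, (A.mulVec x) i < ν * x i) :
    (spectralRadius ℂ (A.map ((↑) : ℝ → ℂ))).toReal < ν := by
  cases isEmpty_or_nonempty ι
  · have : spectralRadius ℂ (A.map ((↑) : ℝ → ℂ)) = 0 := by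
      simp [spectralRadius, spectrum.of_subsingleton]
    simpa [this] using hν
  obtain ⟨z, hz, hzr⟩ := spectrum.exists_nnnorm_eq_spectralRadius (A.map ((↑) : ℝ → ℂ))
  rw [← hzr, ENNReal.coe_toReal, coe_nnnorm]
  rw [← Matrix.spectrum_toLin', ← Module.End.hasEigenvalue_iff_mem_spectrum] at hz
  obtain ⟨v, hv⟩ := hz.exists_hasEigenvector
  have hmul : ∀ i, ∑ j, (A i j : ℂ) * v j = z * v i := fun i => by
    have := congrFun hv.apply_eq_smul i
    simpa [Matrix.mulVec, dotProduct] using this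
  obtain ⟨i, hi⟩ := Finite.exists_max fun i => ‖v i‖ / x i
  set t := ‖v i‖ / x i with ht
  have hvt : ∀ j, ‖v j‖ ≤ t * x j := fun j => (div_le_iff₀ (hx j)).1 (hi j)
  have htpos : 0 < t := by
    by_contra hneg
    refine hv.2 (funext fun j => ?_)
    have h1 := hvt j
    have h2 : t * x j ≤ 0 := mul_nonpos_of_nonpos_of_nonneg (not_lt.1 hneg) (hx j).le
    simpa using norm_le_zero_iff.1 (h1.trans h2)
  have hvi : ‖v i‖ = t * x i := by rw [ht, div_mul_cancel₀ _ (hx i).ne']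
  have key : ‖z‖ * (t * x i) < ν * (t * x i) := by
    calc ‖z‖ * (t * x i) = ‖∑ j, (A i j : ℂ) * v j‖ := by rw [hmul, norm_mul, hvi]
      _ ≤ ∑ j, A i j * (t * x j) := by
        refine (norm_sum_le _ _).trans (Finset.sum_le_sum fun j _ => ?_)
        rw [norm_mul, Complex.norm_real, Real.norm_of_nonneg (hA i j)]
        exact mul_le_mul_of_nonneg_left (hvt j) (hA i j)
      _ = t * (A.mulVec x) i := by
        simp only [Matrix.mulVec, dotProduct, Finset.mul_sum]
        exact Finset.sum_congr rfl fun j _ => by ring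
      _ < t * (ν * x i) := mul_lt_mul_of_pos_left (h i) htpos
      _ = ν * (t * x i) := by ring
  exact lt_of_mul_lt_mul_right key (mul_pos htpos (hx i)).le

/-- By Gelfand's formula the row sums of some power `A ^ n` are smaller than `ν ^ n`; then the
truncated Neumann series `∑ k < n, ν⁻ᵏ Aᵏ 1` is subinvariant. -/
theorem exists_subinvariant_of_spectralRadius_lt (A : Matrix ι ι ℝ) (hA : ∀ i j, 0 ≤ A i j)
    {ν : ℝ} (hν : 0 < ν) (h : (spectralRadius ℂ (A.map ((↑) : ℝ → ℂ))).toReal < ν) :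
    ∃ x : ι → ℝ, (∀ i, 0 < x i) ∧ ∀ i, (A.mulVec x) i < ν * x i := by
  have hpow : ∀ n : ℕ, (A.map ((↑) : ℝ → ℂ)) ^ n = (A ^ n).map ((↑) : ℝ → ℂ) := fun n =>
    (map_pow (Complex.ofRealHom.mapMatrix (m := ι)) A n).symm
  have hAn : ∀ (n : ℕ) i j, 0 ≤ (A ^ n) i j := by
    intro n
    induction n with
    | zero => intro i j; simp only [pow_zero, Matrix.one_apply]; split_ifs <;> norm_num
    | succ n ih =>
      intro i j
      rw [pow_succ, Matrix.mul_apply]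
      exact Finset.sum_nonneg fun k _ => mul_nonneg (ih i k) (hA k j)
  have hlt : spectralRadius ℂ (A.map ((↑) : ℝ → ℂ)) < ENNReal.ofReal ν :=
    (ENNReal.lt_ofReal_iff_toReal_lt (spectralRadius_lt_top_of_matrix _).ne).2 h
  obtain ⟨n, hn, hn1⟩ := (((spectrum.pow_nnnorm_pow_one_div_tendsto_nhds_spectralRadius
    (A.map ((↑) : ℝ → ℂ))).eventually (gt_mem_nhds hlt)).and
    (Filter.eventually_ge_atTop 1)).exists
  have hn0 : (0 : ℝ) < n := by exact_mod_cast hn1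
  have hnorm : ‖(A.map ((↑) : ℝ → ℂ)) ^ n‖₊ < (ν.toNNReal) ^ n := by
    have h1 := ENNReal.rpow_lt_rpow hn hn0
    rw [← ENNReal.rpow_mul, one_div, inv_mul_cancel₀ hn0.ne', ENNReal.rpow_one,
      ENNReal.rpow_natCast, ENNReal.ofReal] at h1
    exact_mod_cast h1
  have hrow : ∀ i, ∑ j, (A ^ n) i j < ν ^ n := by
    intro i
    have h1 : ∑ j, ‖((A ^ n).map ((↑) : ℝ → ℂ)) i j‖₊ ≤ ‖(A ^ n).map ((↑) : ℝ → ℂ)‖₊ := by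
      rw [Matrix.linfty_opNNNorm_def]
      exact Finset.le_sup (f := fun i => ∑ j, ‖((A ^ n).map ((↑) : ℝ → ℂ)) i j‖₊)
        (Finset.mem_univ i)
    have h2 := h1.trans_lt (hpow n ▸ hnorm)
    have h3 : ((∑ j, ‖((A ^ n).map ((↑) : ℝ → ℂ)) i j‖₊ : NNReal) : ℝ) < ν ^ n := by
      have := NNReal.coe_lt_coe.2 h2
      rwa [NNReal.coe_pow, Real.coe_toNNReal _ hν.le] at this
    refine lt_of_eq_of_lt ?_ h3
    rw [NNReal.coe_sum]
    refine Finset.sum_congr rfl fun j _ => ?_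
    rw [coe_nnnorm, Matrix.map_apply, Complex.norm_real, Real.norm_of_nonneg (hAn n i j)]
  let y : ℕ → ι → ℝ := fun k i => (ν ^ k)⁻¹ * ∑ j, (A ^ k) i j
  have hy0 : ∀ k i, 0 ≤ y k i := fun k i =>
    mul_nonneg (by positivity) (Finset.sum_nonneg fun j _ => hAn k i j)
  have hy1 : ∀ i, y 0 i = 1 := fun i => by simp [y, Matrix.one_apply]
  have hyn : ∀ i, y n i < 1 := fun i => by
    have := hrow i
    simp only [y]
    rw [inv_mul_lt_iff₀ (by positivity)]
    simpa using this
  have hyA : ∀ k i, ∑ j, A i j * y k j = ν * y (k + 1) i := by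
    intro k i
    simp only [y, pow_succ' A, Matrix.mul_apply]
    rw [Finset.sum_comm, Finset.mul_sum, Finset.mul_sum]
    refine Finset.sum_congr rfl fun j _ => ?_
    rw [← Finset.mul_sum]
    field_simp
    ring
  refine ⟨fun i => ∑ k ∈ Finset.range n, y k i, fun i => ?_, fun i => ?_⟩
  · refine Finset.sum_pos' (fun k _ => hy0 k i) ⟨0, Finset.mem_range.2 hn1, ?_⟩
    rw [hy1]; exact one_pos
  · have h1 : (A.mulVec fun i => ∑ k ∈ Finset.range n, y k i) i
        = ν * ∑ k ∈ Finset.range n, y (k + 1) i := by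
      simp only [Matrix.mulVec, dotProduct, Finset.mul_sum]
      rw [Finset.sum_comm]
      exact Finset.sum_congr rfl fun k _ => by rw [hyA]
    rw [h1]
    refine mul_lt_mul_of_pos_left ?_ hν
    have h2 := Finset.sum_range_succ (fun k => y k i) n
    have h3 := Finset.sum_range_succ' (fun k => y k i) n
    have := hy1 i
    have := hyn i
    linarith

end Spectral

/-! ### Subinvariant weights on directed edges -/

namespace FinGraph

variable {G H : FinGraph.{u}}

/-- `e₁, e₂` are the successive edges of a non-backtracking walk. -/
def Follows (G : FinGraph.{u}) (e₁ e₂ : G.Edir) : Prop := G.head e₁ = G.tail e₂ ∧ G.inv e₁ ≠ e₂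

open Classical in
theorem hashimoto_eq_map (G : FinGraph.{u}) : G.hashimoto =
    (Matrix.of fun e₁ e₂ => if G.Follows e₁ e₂ then (1 : ℝ) else 0).map ((↑) : ℝ → ℂ) := by
  ext e₁ e₂
  simp only [hashimoto, Matrix.of_apply, Matrix.map_apply]
  by_cases h : G.Follows e₁ e₂
  · rw [if_pos h, if_pos (show G.head e₁ = G.tail e₂ ∧ G.inv e₁ ≠ e₂ from h), Complex.ofReal_one]
  · rw [if_neg h, if_neg (show ¬ (G.head e₁ = G.tail e₂ ∧ G.inv e₁ ≠ e₂) from h),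
      Complex.ofReal_zero]

open Classical in
/-- The Collatz–Wielandt description of the Perron–Frobenius eigenvalue. -/
theorem mu₁_lt_iff {ν : ℝ} (hν : 0 < ν) : G.mu₁ < ν ↔ ∃ x : G.Edir → ℝ, (∀ e, 0 < x e) ∧
    ∀ e, ∑ e' with G.Follows e e', x e' < ν * x e := by
  set A : Matrix G.Edir G.Edir ℝ := Matrix.of fun e₁ e₂ => if G.Follows e₁ e₂ then (1 : ℝ) else 0
    with hA
  have hA0 : ∀ i j, 0 ≤ A i j := fun i j => by
    rw [hA, Matrix.of_apply]; split_ifs <;> norm_num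
  have hAx : ∀ (x : G.Edir → ℝ) e, (A.mulVec x) e = ∑ e' with G.Follows e e', x e' := by
    intro x e
    simp [hA, Matrix.mulVec, dotProduct, Finset.sum_filter]
  rw [mu₁, hashimoto_eq_map]
  constructor
  · intro h
    obtain ⟨x, hx, h'⟩ := exists_subinvariant_of_spectralRadius_lt A hA0 hν h
    exact ⟨x, hx, fun e => hAx x e ▸ h' e⟩
  · rintro ⟨x, hx, h⟩
    exact spectralRadius_lt_of_subinvariant A hA0 hν x hx fun e => (hAx x e).symm ▸ h e

open Classical in
theorem Subgraph.sum_follows (S : G.Subgraph) (x : G.Edir → ℝ) (e : S.toGraph.Edir) :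
    ∑ e' with S.toGraph.Follows e e', x e'.1
      = ∑ e' with e' ∈ S.edges ∧ G.Follows e.1 e', x e' := by
  refine Finset.sum_bij (fun e' _ => e'.1) ?_ ?_ ?_ ?_
  · rintro e' he'
    simp only [Finset.mem_filter, Finset.mem_univ, true_and] at he' ⊢
    exact ⟨e'.2, congrArg Subtype.val he'.1, fun h => he'.2 (Subtype.ext h)⟩
  · exact fun a _ b _ h => Subtype.ext h
  · rintro e' he'
    simp only [Finset.mem_filter, Finset.mem_univ, true_and] at he'
    exact ⟨⟨e', he'.1⟩, Finset.mem_filter.2 ⟨Finset.mem_univ _, Subtype.ext he'.2.1,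
      fun h => he'.2.2 (congrArg Subtype.val h)⟩, rfl⟩
  · exact fun _ _ => rfl

open Classical in
theorem Subgraph.mu₁_lt_iff (S : G.Subgraph) {ν : ℝ} (hν : 0 < ν) :
    S.toGraph.mu₁ < ν ↔ ∃ x : G.Edir → ℝ, ∀ e ∈ S.edges, 0 < x e ∧
      ∑ e' with e' ∈ S.edges ∧ G.Follows e e', x e' < ν * x e := by
  rw [FinGraph.mu₁_lt_iff hν]
  constructor
  · rintro ⟨x, hx, h⟩
    refine ⟨fun e => if he : e ∈ S.edges then x ⟨e, he⟩ else 0, fun e he => ?_⟩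
    have hval : ∀ e' : S.toGraph.Edir,
        (fun e => if he : e ∈ S.edges then x ⟨e, he⟩ else 0) e'.1 = x e' := fun e' => by
      exact dif_pos e'.2
    exact ⟨(hx ⟨e, he⟩).trans_eq (hval ⟨e, he⟩).symm,
      lt_of_eq_of_lt ((S.sum_follows _ ⟨e, he⟩).symm.trans (Finset.sum_congr rfl fun e' _ => hval e'))
        ((h ⟨e, he⟩).trans_eq (congrArg (ν * ·) (hval ⟨e, he⟩).symm))⟩
  · rintro ⟨x, hx⟩
    exact ⟨fun e => x e.1, fun e => (hx e.1 e.2).1, fun e => by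
      rw [S.sum_follows]; exact (hx e.1 e.2).2⟩

/-! ### Invariance under isomorphism -/

theorem Iso.follows_iff (f : Iso G H) {e e' : G.Edir} :
    H.Follows (f.onE e) (f.onE e') ↔ G.Follows e e' := by
  simp [Follows, f.map_head, f.map_tail, f.map_inv]

/-- The inverse of an isomorphism. -/
def Iso.symm (f : Iso G H) : Iso H G where
  onV := f.onV.symm
  onE := f.onE.symm
  map_head e := by rw [Equiv.eq_symm_apply, ← f.map_head, Equiv.apply_symm_apply]
  map_tail e := by rw [Equiv.eq_symm_apply, ← f.map_tail, Equiv.apply_symm_apply]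
  map_inv e := by rw [Equiv.eq_symm_apply, ← f.map_inv, Equiv.apply_symm_apply]

open Classical in
theorem Iso.mu₁_lt (f : Iso G H) {ν : ℝ} (hν : 0 < ν) (h : H.mu₁ < ν) : G.mu₁ < ν := by
  rw [mu₁_lt_iff hν] at h ⊢
  obtain ⟨x, hx, h⟩ := h
  refine ⟨fun e => x (f.onE e), fun e => hx _, fun e => lt_of_eq_of_lt ?_ (h (f.onE e))⟩
  refine Finset.sum_equiv f.onE (fun e' => ?_) fun _ _ => rfl
  simp [f.follows_iff]

theorem Iso.ord_eq (f : Iso G H) : G.ord = H.ord := by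
  have h1 : Nat.card G.Edge = Nat.card H.Edge := by
    refine Nat.card_congr (Quotient.congr f.onE fun a b => ?_)
    change (b = a ∨ b = G.inv a) ↔ (f.onE b = f.onE a ∨ f.onE b = H.inv (f.onE a))
    simp [f.map_inv]
  rw [ord, ord, h1, Nat.card_congr f.onV]

theorem Iso.connected (f : Iso G H) (h : G.Connected) : H.Connected := by
  obtain ⟨⟨v⟩, h⟩ := h
  refine ⟨⟨f.onV v⟩, fun v w => ?_⟩
  have := (h (f.onV.symm v) (f.onV.symm w)).lift (p := fun v w => ∃ e, H.tail e = v ∧ H.head e = w)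
    f.onV (by
      rintro a b ⟨e, rfl, rfl⟩
      exact ⟨f.onE e, f.map_tail e, f.map_head e⟩)
  simpa [Reachable, Function.onFun] using this

theorem Iso.isTangle (f : Iso G H) {ν : ℝ} (hν : 0 < ν) {r : ℤ} (h : IsTangle ν r G) :
    IsTangle ν r H :=
  ⟨f.connected h.1, not_lt.1 fun hlt => h.2.1.not_gt (f.mu₁_lt hν hlt), f.ord_eq ▸ h.2.2⟩

/-! ### Subgraphs of subgraphs -/

/-- A subgraph of a subgraph, regarded as a subgraph of the ambient graph. -/
def Subgraph.lift (S : G.Subgraph) (U : S.toGraph.Subgraph) : G.Subgraph where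
  verts := Subtype.val '' U.verts
  edges := Subtype.val '' U.edges
  head_mem := by
    rintro _ ⟨e, he, rfl⟩
    exact ⟨_, U.head_mem e he, rfl⟩
  inv_mem := by
    rintro _ ⟨e, he, rfl⟩
    exact ⟨_, U.inv_mem e he, rfl⟩

/-- Lifting a subgraph to the ambient graph does not change its isomorphism type. -/
noncomputable def Subgraph.liftIso (S : G.Subgraph) (U : S.toGraph.Subgraph) :
    Iso U.toGraph (S.lift U).toGraph where
  onV := Equiv.Set.image Subtype.val U.verts Subtype.val_injective
  onE := Equiv.Set.image Subtype.val U.edges Subtype.val_injective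
  map_head _ := rfl
  map_tail _ := rfl
  map_inv _ := rfl

/-- The whole graph as a subgraph. -/
def Subgraph.whole (G : FinGraph.{u}) : G.Subgraph where
  verts := Set.univ
  edges := Set.univ
  head_mem _ _ := trivial
  inv_mem _ _ := trivial

/-- The whole subgraph is isomorphic to the graph. -/
def Subgraph.wholeIso (G : FinGraph.{u}) : Iso (Subgraph.whole G).toGraph G where
  onV := Equiv.Set.univ _
  onE := Equiv.Set.univ _
  map_head _ := rfl
  map_tail _ := rfl
  map_inv _ := rfl

theorem exists_isMinimalTangle {ν : ℝ} (hν : 0 < ν) {r : ℤ} (S : G.Subgraph)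
    (hS : IsTangle ν r S.toGraph) : ∃ U : G.Subgraph, IsMinimalTangle ν r U.toGraph := by
  obtain ⟨n, hn⟩ : ∃ n, S.verts.ncard + S.edges.ncard = n := ⟨_, rfl⟩
  induction n using Nat.strong_induction_on generalizing S with
  | _ n ih =>
    by_cases hmin : IsMinimalTangle ν r S.toGraph
    · exact ⟨S, hmin⟩
    have : ∃ U : S.toGraph.Subgraph, U.IsProper ∧ IsTangle ν r U.toGraph := by
      by_contra hcon
      push Not at hcon
      exact hmin ⟨hS, hcon⟩
    obtain ⟨U, hU, hUt⟩ := this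
    have hV : (S.lift U).verts ⊆ S.verts := by rintro _ ⟨v, -, rfl⟩; exact v.2
    have hE : (S.lift U).edges ⊆ S.edges := by rintro _ ⟨v, -, rfl⟩; exact v.2
    refine ih _ ?_ (S.lift U) ((S.liftIso U).isTangle hν hUt) rfl
    rw [← hn]
    have hVle := Set.ncard_le_ncard hV
    have hEle := Set.ncard_le_ncard hE
    have huniv : ∀ {α : Type u} {s : Set α} {t : Set s}, Subtype.val '' t = s → t = Set.univ :=
      fun {α s t} h => Set.eq_univ_of_forall fun a => by
        obtain ⟨b, hb, hba⟩ := h.symm.subset a.2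
        rwa [← Subtype.ext hba]
    rcases hU with hU | hU
    · have : (S.lift U).verts.ncard < S.verts.ncard :=
        Set.ncard_lt_ncard (hV.ssubset_of_ne fun h => hU (huniv h))
      lia
    · have : (S.lift U).edges.ncard < S.edges.ncard :=
        Set.ncard_lt_ncard (hE.ssubset_of_ne fun h => hU (huniv h))
      lia

/-! ### Connected components and orders of connected subgraphs -/

theorem Reachable.symm {v w : G.V} (h : G.Reachable v w) : G.Reachable w v := by
  induction h with
  | refl => exact Relation.ReflTransGen.refl
  | tail _ h2 ih =>
    obtain ⟨e, rfl, rfl⟩ := h2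
    exact Relation.ReflTransGen.head ⟨G.inv e, G.tail_inv e, G.head_inv e⟩ ih

theorem component_eq {v w : G.V} (h : G.Reachable v w) : G.component v = G.component w := by
  have key : ∀ u, G.Reachable v u ↔ G.Reachable w u := fun u => ⟨h.symm.trans, h.trans⟩
  simp only [component, key]

theorem component_connected (v : G.V) : (G.component v).toGraph.Connected := by
  have key : ∀ w (h : G.Reachable v w),
      (G.component v).toGraph.Reachable ⟨v, Relation.ReflTransGen.refl⟩ ⟨w, h⟩ := by
    intro w h
    induction h with
    | refl => exact Relation.ReflTransGen.refl
    | tail h1 h2 ih =>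
      obtain ⟨e, rfl, rfl⟩ := h2
      exact Relation.ReflTransGen.tail ih ⟨⟨e, h1⟩, rfl, rfl⟩
  exact ⟨⟨⟨v, Relation.ReflTransGen.refl⟩⟩, fun a b => (key a.1 a.2).symm.trans (key b.1 b.2)⟩

open Classical in
/-- Weights that are subinvariant on each component can be glued, since the successors of an edge
lie in the component of that edge. -/
theorem exists_component_le_mu₁ {ν : ℝ} (hν : 0 < ν) (h : ν ≤ G.mu₁) :
    ∃ v, ν ≤ (G.component v).toGraph.mu₁ := by
  by_contra hcon
  push Not at hcon
  refine h.not_gt ((mu₁_lt_iff hν).2 ?_)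
  have hw : ∀ S : G.Subgraph, ∃ x : G.Edir → ℝ, S.toGraph.mu₁ < ν → ∀ e ∈ S.edges, 0 < x e ∧
      ∑ e' with e' ∈ S.edges ∧ G.Follows e e', x e' < ν * x e := by
    intro S
    by_cases hS : S.toGraph.mu₁ < ν
    · obtain ⟨x, hx⟩ := (S.mu₁_lt_iff hν).1 hS
      exact ⟨x, fun _ => hx⟩
    · exact ⟨0, fun h => absurd h hS⟩
  choose w hw using hw
  have hmem : ∀ e, e ∈ (G.component (G.tail e)).edges := fun e => Relation.ReflTransGen.refl
  refine ⟨fun e => w (G.component (G.tail e)) e, fun e => (hw _ (hcon _) e (hmem e)).1,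
    fun e => lt_of_eq_of_lt ?_ (hw _ (hcon _) e (hmem e)).2⟩
  have hreach : ∀ e', G.Follows e e' → G.Reachable (G.tail e) (G.tail e') := fun e' he' =>
    Relation.ReflTransGen.single ⟨e, rfl, he'.1⟩
  refine Finset.sum_congr ?_ fun e' he' => ?_
  · ext e'
    simp only [Finset.mem_filter, Finset.mem_univ, true_and]
    exact ⟨fun h => ⟨hreach e' h, h⟩, fun h => h.2⟩
  · simp only [Finset.mem_filter, Finset.mem_univ, true_and] at he'
    rw [component_eq (hreach e' he'.2)]

/-- Contracting a non-empty subgraph of a connected graph leaves a connected graph, which has at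
least as many edges as vertices other than the contracted one: every vertex `v` outside the
subgraph is assigned the first edge of a shortest walk from `v` to the subgraph. -/
theorem Connected.ord_subgraph_le (hG : G.Connected) (S : G.Subgraph) (hS : S.verts.Nonempty) :
    S.toGraph.ord ≤ G.ord := by
  classical
  obtain ⟨s, hs⟩ := hS
  -- `N n` is the set of starting points of walks of length `n` that end in `S`.
  let N : ℕ → Set G.V := fun n =>
    Nat.rec S.verts (fun _ T => {v | ∃ e, G.tail e = v ∧ G.head e ∈ T}) n
  have hN : ∀ v, ∃ n, v ∈ N n := by
    intro v
    induction hG.2 v s using Relation.ReflTransGen.head_induction_on with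
    | refl => exact ⟨0, hs⟩
    | head h _ ih =>
      obtain ⟨e, he, he'⟩ := h
      obtain ⟨n, hn⟩ := ih
      exact ⟨n + 1, e, he, he'.symm ▸ hn⟩
  let d : G.V → ℕ := fun v => sInf {n | v ∈ N n}
  have hd : ∀ v : {v // v ∉ S.verts}, ∃ e, G.tail e = v ∧ d (G.head e) < d v := by
    rintro ⟨v, hv⟩
    have h1 : v ∈ N (d v) := Nat.sInf_mem (hN v)
    cases hdv : d v with
    | zero => exact absurd (show v ∈ N 0 by rwa [hdv] at h1) hv
    | succ n =>
      obtain ⟨e, he, he'⟩ : ∃ e, G.tail e = v ∧ G.head e ∈ N n := by rwa [hdv] at h1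
      exact ⟨e, he, Nat.lt_succ_of_le (Nat.sInf_le he')⟩
  choose ε hε hεd using hd
  let φ : S.toGraph.Edge ⊕ {v // v ∉ S.verts} → G.Edge :=
    Sum.elim (Quotient.map' Subtype.val fun a b (h : b = a ∨ b = S.toGraph.inv a) =>
      h.imp (congrArg Subtype.val) (congrArg Subtype.val)) fun v => Quotient.mk _ (ε v)
  have hφ : Function.Injective φ := by
    refine Function.Injective.sumElim ?_ ?_ ?_
    · rintro ⟨a⟩ ⟨b⟩ h
      have h' : b.1 = a.1 ∨ b.1 = G.inv a.1 := Quotient.exact h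
      exact Quotient.sound (s := S.toGraph.edgeSetoid)
        (h'.imp (fun h => Subtype.ext h) fun h => Subtype.ext h)
    · intro v w h
      have h' : ε w = ε v ∨ ε w = G.inv (ε v) := Quotient.exact h
      rcases h' with h' | h'
      · exact Subtype.ext (by rw [← hε v, ← hε w, h'])
      · have h1 := hεd v
        have h2 := hεd w
        rw [← hε w, h', G.head_inv, G.tail_inv, hε v] at h2
        exact absurd h1 h2.not_gt
    · rintro ⟨a⟩ v h
      have h' : ε v = a.1 ∨ ε v = G.inv a.1 := Quotient.exact h
      have hmem : ε v ∈ S.edges := by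
        rcases h' with h' | h' <;> rw [h']
        · exact a.2
        · exact S.inv_mem _ a.2
      exact v.2 (hε v ▸ S.tail_mem _ hmem)
  have h1 := Nat.card_le_card_of_injective φ hφ
  have h2 : Nat.card S.toGraph.V + Nat.card {v // v ∉ S.verts} = Nat.card G.V := by
    rw [← Nat.card_sum]
    exact Nat.card_congr (Equiv.Set.sumCompl S.verts)
  rw [Nat.card_sum] at h1
  rw [ord, ord]
  lia

theorem IsMinimalTangle.mu₁_lt {ν : ℝ} (hν : 0 < ν) {r : ℤ} (hG : IsMinimalTangle ν r G)
    (S : G.Subgraph) (hS : S.edges ≠ Set.univ) : S.toGraph.mu₁ < ν := by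
  by_contra hcon
  obtain ⟨v, hv⟩ := exists_component_le_mu₁ hν (not_lt.1 hcon)
  have f := S.liftIso (S.toGraph.component v)
  have hconn := f.connected (component_connected v)
  refine hG.2 (S.lift (S.toGraph.component v)) (Or.inr fun h => hS ?_)
    ⟨hconn, not_lt.1 fun hlt => hv.not_gt (f.mu₁_lt hν hlt), ?_⟩
  · refine Set.eq_univ_of_univ_subset (h ▸ ?_)
    rintro _ ⟨e, -, rfl⟩
    exact e.2
  · obtain ⟨w⟩ := hconn.1
    exact (hG.1.1.ord_subgraph_le _ ⟨w.1, w.2⟩).trans_lt hG.1.2.2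

/-! ### Degrees, orders and branching edges -/

theorem degree_eq_card [DecidableEq G.V] (v : G.V) :
    G.degree v = (Finset.univ.filter fun e => G.head e = v).card := by
  rw [degree, Nat.card_eq_fintype_card, Fintype.card_subtype]

/-- An edge is branching if its head has degree at least three. -/
def branching (G : FinGraph.{u}) : Set G.Edir := {e | 3 ≤ G.degree (G.head e)}

theorem card_edir_le (G : FinGraph.{u}) : Nat.card G.Edir ≤ 2 * Nat.card G.Edge := by
  classical
  have := Fintype.ofFinite G.Edge
  rw [Nat.card_eq_fintype_card, Nat.card_eq_fintype_card]
  refine (Finset.card_le_mul_card_image (s := Finset.univ)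
    (f := fun e : G.Edir => (Quotient.mk G.edgeSetoid e : G.Edge)) 2 ?_).trans
    (Nat.mul_le_mul_left 2 (Finset.card_le_univ _))
  intro a ha
  obtain ⟨e, -, rfl⟩ := Finset.mem_image.1 ha
  refine (Finset.card_le_card (t := {e, G.inv e}) fun e' he' => ?_).trans Finset.card_le_two
  have : e = e' ∨ e = G.inv e' := Quotient.exact (Finset.mem_filter.1 he').2
  rcases this with rfl | rfl
  · simp
  · simp [G.inv_inv]

theorem sum_degree [Fintype G.V] : ∑ v, G.degree v = Nat.card G.Edir := by
  rw [← Nat.card_congr (Equiv.sigmaFiberEquiv G.head), Nat.card_sigma]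
  rfl

theorem sum_degree_sub_two_le [Fintype G.V] : ∑ v, ((G.degree v : ℤ) - 2) ≤ 2 * G.ord := by
  have h1 := G.card_edir_le
  rw [Finset.sum_sub_distrib, ← Nat.cast_sum, sum_degree, ord]
  simp only [Finset.sum_const, Finset.card_univ, ← Nat.card_eq_fintype_card]
  have h2 : (Nat.card G.Edir : ℤ) ≤ 2 * Nat.card G.Edge := by exact_mod_cast h1
  simp only [nsmul_eq_mul]
  linarith

theorem Pruned.ord_pos (hP : G.Pruned) (h : G.branching.Nonempty) : 0 < G.ord := by
  have := Fintype.ofFinite G.V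
  obtain ⟨e, he⟩ := h
  have h1 : (0 : ℤ) < ∑ v, ((G.degree v : ℤ) - 2) := by
    refine Finset.sum_pos' (fun v _ => ?_) ⟨G.head e, Finset.mem_univ _, ?_⟩
    · have := hP v
      lia
    · have : 3 ≤ G.degree (G.head e) := he
      lia
  linarith [G.sum_degree_sub_two_le]

/-- Each vertex of degree `d ≥ 3` is the head of `d ≤ 3 (d - 2)` branching edges. -/
theorem Pruned.ncard_branching_le (hP : G.Pruned) : (G.branching.ncard : ℤ) ≤ 6 * G.ord := by
  classical
  have := Fintype.ofFinite G.V
  have h1 : G.branching.ncard = ∑ v, if 3 ≤ G.degree v then G.degree v else 0 := by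
    rw [Set.ncard_eq_toFinset_card', Finset.card_eq_sum_card_fiberwise (f := G.head)
      (t := Finset.univ) (fun _ _ => Finset.mem_coe.2 (Finset.mem_univ _))]
    refine Finset.sum_congr rfl fun v _ => ?_
    split_ifs with h
    · rw [degree_eq_card]
      congr 1
      ext e
      rw [Finset.mem_filter, Finset.mem_filter, Set.mem_toFinset]
      exact ⟨fun he => ⟨Finset.mem_univ _, he.2⟩,
        fun he => ⟨show 3 ≤ G.degree (G.head e) by rwa [he.2], he.2⟩⟩
    · rw [Finset.card_eq_zero, Finset.filter_eq_empty_iff]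
      intro e he hev
      rw [Set.mem_toFinset] at he
      exact h (hev ▸ he)
  have h2 : (G.branching.ncard : ℤ) ≤ ∑ v, 3 * ((G.degree v : ℤ) - 2) := by
    rw [h1, Nat.cast_sum]
    refine Finset.sum_le_sum fun v _ => ?_
    have := hP v
    split_ifs <;> lia
  rw [← Finset.mul_sum] at h2
  linarith [G.sum_degree_sub_two_le]

theorem Pruned.two_mul_card_le (hP : G.Pruned) : 2 * Nat.card G.V ≤ Nat.card G.Edir := by
  have := Fintype.ofFinite G.V
  rw [← sum_degree, Nat.card_eq_fintype_card, mul_comm, ← Finset.card_univ, ← smul_eq_mul]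
  exact Finset.card_nsmul_le_sum _ _ _ fun v _ => hP v

theorem Pruned.exists_follows (hP : G.Pruned) (e : G.Edir) : ∃ e', G.Follows e e' := by
  classical
  have h := hP (G.head e)
  rw [degree_eq_card] at h
  obtain ⟨f, hf, hfe⟩ := Finset.exists_mem_ne (Nat.lt_of_succ_le h) e
  refine ⟨G.inv f, ?_, fun h => hfe ?_⟩
  · rw [G.tail_inv]
    exact (Finset.mem_filter.1 hf).2.symm
  · rw [← G.inv_inv f, ← h, G.inv_inv]

theorem eq_of_degree_lt_three {v : G.V} (hv : G.degree v < 3) {a b c : G.Edir} (ha : G.head a = v)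
    (hb : G.head b = v) (hc : G.head c = v) (hab : a ≠ b) (hac : a ≠ c) : b = c := by
  classical
  by_contra hbc
  rw [degree_eq_card] at hv
  refine hv.not_ge ?_
  rw [← Finset.card_eq_three.2 ⟨a, b, c, hab, hac, hbc, rfl⟩]
  refine Finset.card_le_card fun e he => ?_
  simp only [Finset.mem_insert, Finset.mem_singleton] at he
  rcases he with rfl | rfl | rfl <;> simp [*]

theorem Follows.inv {e e' : G.Edir} (h : G.Follows e e') : G.Follows (G.inv e') (G.inv e) :=
  ⟨by rw [G.head_inv, G.tail_inv, h.1], fun h' => h.2 (by rw [← h', G.inv_inv])⟩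

theorem Follows.eq_of_left {e e' e'' : G.Edir} (he : e ∉ G.branching) (h' : G.Follows e e')
    (h'' : G.Follows e e'') : e' = e'' := by
  have := eq_of_degree_lt_three (not_le.1 he) (a := e) (b := G.inv e') (c := G.inv e'') rfl
    (by rw [G.head_inv, h'.1]) (by rw [G.head_inv, h''.1])
    (fun h => h'.2 (by rw [h, G.inv_inv])) (fun h => h''.2 (by rw [h, G.inv_inv]))
  rw [← G.inv_inv e', this, G.inv_inv]

theorem inv_mem_branching_iff {e e' : G.Edir} (h : G.Follows e e') :
    G.inv e' ∈ G.branching ↔ e ∈ G.branching := by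
  simp only [branching, Set.mem_ofPred_eq, G.head_inv, h.1]

theorem Follows.eq_of_right {e e' f : G.Edir} (he : e ∉ G.branching) (h : G.Follows e f)
    (h' : G.Follows e' f) : e = e' := by
  have := h.inv.eq_of_left (fun hf => he ((inv_mem_branching_iff h).1 hf)) h'.inv
  rw [← G.inv_inv e, this, G.inv_inv]

/-! ### Chains of non-branching edges -/

open Classical in
/-- Some edge that follows `e`; it is the only one if `e` is not branching. An edge that is
followed by no edge is mapped to itself. -/
noncomputable def next (G : FinGraph.{u}) (e : G.Edir) : G.Edir :=
  if h : ∃ e', G.Follows e e' then h.choose else e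

theorem Pruned.follows_next (hP : G.Pruned) (e : G.Edir) : G.Follows e (G.next e) := by
  have h := hP.exists_follows e
  rw [next, dif_pos h]
  exact h.choose_spec

/-- If no edge of the walk `e, next e, …` were branching, the heads of its edges would form a
union of components without vertices of degree three. -/
theorem Connected.exists_iterate_next_mem_branching (hG : G.Connected) (hP : G.Pruned)
    (hB : G.branching.Nonempty) (e : G.Edir) : ∃ k, G.next^[k] e ∈ G.branching := by
  by_contra hcon
  push Not at hcon
  set O : Set G.Edir := Set.range fun k => G.next^[k] e with hO
  have hOB : ∀ f ∈ O, f ∉ G.branching := by rintro _ ⟨k, rfl⟩; exact hcon k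
  have hmaps : Set.MapsTo G.next O O := by
    rintro _ ⟨k, rfl⟩
    exact ⟨k + 1, Function.iterate_succ_apply' _ _ _⟩
  have hinj : Set.InjOn G.next O := fun a ha b _ hab =>
    (hP.follows_next a).eq_of_right (hOB a ha) (hab ▸ hP.follows_next b)
  have hsurj : Set.SurjOn G.next O O :=
    (((Set.toFinite O).injOn_iff_bijOn_of_mapsTo hmaps).1 hinj).surjOn
  have hreach : ∀ v, G.Reachable (G.head e) v → ∃ f ∈ O, G.head f = v := by
    intro v hv
    induction hv with
    | refl => exact ⟨e, ⟨0, rfl⟩, rfl⟩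
    | tail _ h ih =>
      obtain ⟨g, hg, rfl⟩ := h
      obtain ⟨f, hf, hfv⟩ := ih
      by_cases hfg : G.inv f = g
      · obtain ⟨f', hf', hff'⟩ := hsurj hf
        refine ⟨f', hf', ?_⟩
        rw [(hP.follows_next f').1, hff', ← hfg, G.head_inv]
      · have h1 : G.Follows f g := ⟨hfv.trans hg.symm, hfg⟩
        exact ⟨G.next f, hmaps hf,
          congrArg G.head ((hP.follows_next f).eq_of_left (hOB f hf) h1)⟩
  obtain ⟨b, hb⟩ := hB
  obtain ⟨f, hf, hfb⟩ := hreach _ (hG.2 (G.head e) (G.head b))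
  refine hOB f hf ?_
  have : 3 ≤ G.degree (G.head b) := hb
  exact show 3 ≤ G.degree (G.head f) from hfb ▸ this

/-- The number of steps from `e` to the first branching edge along non-backtracking walks; it
is `0` if there is none. -/
noncomputable def toBranch (G : FinGraph.{u}) (e : G.Edir) : ℕ :=
  sInf {k | G.next^[k] e ∈ G.branching}

/-- The length of the maximal chain through `e`, that is, of the path through `e` whose interior
vertices have degree two and whose ends have degree at least three. (A path that runs to a vertex
incident with a half-loop, through the half-loop and back again is a chain as well.) -/
noncomputable def chainLength (G : FinGraph.{u}) (e : G.Edir) : ℕ :=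
  G.toBranch e + G.toBranch (G.inv e) + 1

theorem toBranch_eq_zero {e : G.Edir} (he : e ∈ G.branching) : G.toBranch e = 0 :=
  Nat.sInf_eq_zero.2 (Or.inl he)

theorem chainLength_inv (e : G.Edir) : G.chainLength (G.inv e) = G.chainLength e := by
  rw [chainLength, chainLength, G.inv_inv, add_comm (G.toBranch _)]

section Chains

variable (hG : G.Connected) (hP : G.Pruned) (hB : G.branching.Nonempty)

include hG hP hB

theorem toBranch_eq_succ {e f : G.Edir} (he : e ∉ G.branching) (h : G.Follows e f) :
    G.toBranch e = G.toBranch f + 1 := by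
  have hf : f = G.next e := h.eq_of_left he (hP.follows_next e)
  subst hf
  refine le_antisymm (Nat.sInf_le ?_) ?_
  · exact Nat.sInf_mem (hG.exists_iterate_next_mem_branching hP hB (G.next e))
  · have h1 : G.next^[G.toBranch e] e ∈ G.branching :=
      Nat.sInf_mem (hG.exists_iterate_next_mem_branching hP hB e)
    cases hk : G.toBranch e with
    | zero => exact absurd (by simpa [hk] using h1) he
    | succ n =>
      rw [hk] at h1
      exact Nat.succ_le_succ (Nat.sInf_le h1)

theorem toBranch_inv_eq_succ {e f : G.Edir} (he : e ∉ G.branching) (h : G.Follows e f) :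
    G.toBranch (G.inv f) = G.toBranch (G.inv e) + 1 :=
  toBranch_eq_succ hG hP hB (fun hf => he ((inv_mem_branching_iff h).1 hf)) h.inv

theorem chainLength_eq {e f : G.Edir} (he : e ∉ G.branching) (h : G.Follows e f) :
    G.chainLength f = G.chainLength e := by
  rw [chainLength, chainLength, toBranch_inv_eq_succ hG hP hB he h,
    toBranch_eq_succ hG hP hB he h]
  ring

/-- An edge is determined by the branching edge at the end of its chain and by its distance from
that edge. -/
theorem exists_chainEnd : ∃ β : G.Edir → G.Edir, (∀ e, β e ∈ G.branching) ∧
    (∀ e, G.chainLength (β e) = G.chainLength e) ∧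
    ∀ e e', β e = β e' → G.toBranch e = G.toBranch e' → e = e' := by
  have hbranch : ∀ e, G.toBranch e = 0 → e ∈ G.branching := by
    intro e he
    by_contra hcon
    have := toBranch_eq_succ hG hP hB hcon (hP.follows_next e)
    lia
  have hnot : ∀ e n, G.toBranch e = n + 1 → e ∉ G.branching ∧ G.toBranch (G.next e) = n := by
    intro e n hn
    have he : e ∉ G.branching := fun he => by rw [toBranch_eq_zero he] at hn; lia
    have := toBranch_eq_succ hG hP hB he (hP.follows_next e)
    exact ⟨he, by lia⟩
  have key : ∀ n e, G.toBranch e = n → G.next^[n] e ∈ G.branching ∧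
      G.chainLength (G.next^[n] e) = G.chainLength e := by
    intro n
    induction n with
    | zero => exact fun e he => ⟨hbranch e he, rfl⟩
    | succ n ih =>
      intro e he
      obtain ⟨h1, h2⟩ := hnot e n he
      rw [Function.iterate_succ_apply]
      exact ⟨(ih _ h2).1, (ih _ h2).2.trans (chainLength_eq hG hP hB h1 (hP.follows_next e))⟩
  have inj : ∀ n e e', G.toBranch e = n → G.toBranch e' = n → G.next^[n] e = G.next^[n] e' →
      e = e' := by
    intro n
    induction n with
    | zero => exact fun _ _ _ _ h => h
    | succ n ih =>
      intro e e' he he' h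
      obtain ⟨h1, h2⟩ := hnot e n he
      obtain ⟨-, h4⟩ := hnot e' n he'
      have h5 := ih _ _ h2 h4 h
      exact (hP.follows_next e).eq_of_right h1 (h5 ▸ hP.follows_next e')
  refine ⟨fun e => G.next^[G.toBranch e] e, fun e => (key _ e rfl).1, fun e => (key _ e rfl).2,
    fun e e' h h' => inj _ e e' rfl h'.symm ?_⟩
  have h : G.next^[G.toBranch e] e = G.next^[G.toBranch e'] e' := h
  rwa [← h'] at h

theorem ncard_chainLength_lt_le (n : ℕ) :
    {e | G.chainLength e < n}.ncard ≤ G.branching.ncard * n := by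
  obtain ⟨β, hβ, -, hinj⟩ := exists_chainEnd hG hP hB
  have h1 : (G.branching ×ˢ (Finset.range n : Set ℕ)).ncard = G.branching.ncard * n := by
    rw [Set.ncard_prod, Set.ncard_coe_finset, Finset.card_range]
  rw [← h1]
  refine Set.ncard_le_ncard_of_injOn (fun e => (β e, G.toBranch e)) (fun e he => ⟨hβ e, ?_⟩)
    (fun e _ e' _ h => hinj e e' (congrArg Prod.fst h) (congrArg Prod.snd h))
    ((Set.toFinite _).prod (Finset.finite_toSet _))
  have : G.chainLength e < n := he
  rw [chainLength] at this
  simp only [Finset.coe_range, Set.mem_Iio]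
  lia

theorem ncard_range_chainLength_le : (Set.range G.chainLength).ncard ≤ G.branching.ncard := by
  obtain ⟨β, hβ, hlen, -⟩ := exists_chainEnd hG hP hB
  have : Set.range G.chainLength ⊆ G.chainLength '' G.branching := by
    rintro _ ⟨e, rfl⟩
    exact ⟨β e, hβ e, hlen e⟩
  exact (Set.ncard_le_ncard this).trans (Set.ncard_image_le)

end Chains

end FinGraph

/-! ### Uniform slack in the subinvariance inequalities -/

theorem Finite.exists_pos_le_of_pos {ι : Type*} [Finite ι] (f : ι → ℝ) (hf : ∀ i, 0 < f i) :
    ∃ m, 0 < m ∧ m ≤ 1 ∧ ∀ i, m ≤ f i := by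
  cases isEmpty_or_nonempty ι
  · exact ⟨1, one_pos, le_rfl, fun i => isEmptyElim i⟩
  · obtain ⟨i, hi⟩ := Finite.exists_min f
    exact ⟨min 1 (f i), lt_min one_pos (hf i), min_le_left _ _,
      fun j => (min_le_right _ _).trans (hi j)⟩

open Classical in
theorem exists_slack {ι : Type*} [Fintype ι] (R : ι → ι → Prop) {ν : ℝ} (x : ι → ℝ)
    (hx : ∀ i, 0 < x i) (h : ∀ i, ∑ j with R i j, x j < ν * x i) :
    ∃ m, 0 < m ∧ m ≤ 1 ∧ ∃ y : ι → ℝ,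
      ∀ i, m ≤ y i ∧ y i ≤ 1 ∧ ∑ j with R i j, y j + m ≤ ν * y i := by
  set s : ℝ := ∑ i, x i
  have hs : 0 ≤ s := Finset.sum_nonneg fun i _ => (hx i).le
  set t : ℝ := (s + 1)⁻¹
  have ht : 0 < t := by positivity
  obtain ⟨m, hm, hm1, hmle⟩ := Finite.exists_pos_le_of_pos
    (fun i => min (t * x i) (t * (ν * x i - ∑ j with R i j, x j)))
    fun i => lt_min (mul_pos ht (hx i)) (mul_pos ht (sub_pos.2 (h i)))
  refine ⟨m, hm, hm1, fun i => t * x i, fun i => ⟨(hmle i).trans (min_le_left _ _), ?_, ?_⟩⟩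
  · have : x i ≤ s := Finset.single_le_sum (fun i _ => (hx i).le) (Finset.mem_univ i)
    rw [inv_mul_le_iff₀ (by positivity)]
    linarith
  · have := (hmle i).trans (min_le_right _ _)
    rw [← Finset.mul_sum]
    linarith

open Classical in
/-- There are only finitely many relations on sets of bounded size, so that the slack can be
chosen independently of the relation. -/
theorem exists_uniform_slack (ν : ℝ) (N : ℕ) : ∃ m, 0 < m ∧ m ≤ 1 ∧
    ∀ (ι : Type u) [Fintype ι] (R : ι → ι → Prop), Fintype.card ι ≤ N →
      (∃ x : ι → ℝ, (∀ i, 0 < x i) ∧ ∀ i, ∑ j with R i j, x j < ν * x i) →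
      ∃ y : ι → ℝ, ∀ i, m ≤ y i ∧ y i ≤ 1 ∧ ∑ j with R i j, y j + m ≤ ν * y i := by
  have hex : ∀ p : Σ k : Fin (N + 1), Fin k → Fin k → Prop, ∃ m, 0 < m ∧ m ≤ 1 ∧
      ((∃ x : Fin p.1 → ℝ, (∀ i, 0 < x i) ∧ ∀ i, ∑ j with p.2 i j, x j < ν * x i) →
      ∃ y : Fin p.1 → ℝ, ∀ i, m ≤ y i ∧ y i ≤ 1 ∧ ∑ j with p.2 i j, y j + m ≤ ν * y i) := by
    intro p
    by_cases hp : ∃ x : Fin p.1 → ℝ, (∀ i, 0 < x i) ∧ ∀ i, ∑ j with p.2 i j, x j < ν * x i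
    · obtain ⟨x, hx, h⟩ := hp
      obtain ⟨m, hm, hm1, hy⟩ := exists_slack p.2 x hx h
      exact ⟨m, hm, hm1, fun _ => hy⟩
    · exact ⟨1, one_pos, le_rfl, fun h => absurd h hp⟩
  choose μ hμ _ hμy using hex
  obtain ⟨m, hm, hm1, hmle⟩ := Finite.exists_pos_le_of_pos μ hμ
  refine ⟨m, hm, hm1, fun ι _ R hι => ?_⟩
  rintro ⟨x, hx, h⟩
  let E := Fintype.equivFin ι
  let p : Σ k : Fin (N + 1), Fin k → Fin k → Prop :=
    ⟨⟨Fintype.card ι, Nat.lt_succ_of_le hι⟩, fun i j => R (E.symm i) (E.symm j)⟩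
  have hsum : ∀ (z : Fin (Fintype.card ι) → ℝ) i,
      ∑ j with R i j, z (E j) = ∑ j with R i (E.symm j), z j := fun z i =>
    Finset.sum_equiv E (fun j => by simp) fun _ _ => rfl
  obtain ⟨y, hy⟩ := hμy p ⟨fun i => x (E.symm i), fun i => hx _, fun i => by
    refine lt_of_eq_of_lt ?_ (h (E.symm i))
    simpa using (hsum (fun i => x (E.symm i)) (E.symm i)).symm⟩
  refine ⟨fun i => y (E i), fun i => ?_⟩
  obtain ⟨h1, h2, h3⟩ := hy (E i)
  refine ⟨(hmle p).trans h1, h2, ?_⟩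
  rw [hsum]
  have h4 : ∑ j with R i (E.symm j), y j + μ p ≤ ν * y (E i) := by simpa [p] using h3
  linarith [hmle p]

namespace FinGraph

variable {G : FinGraph.{u}}

/-! ### Structure of minimal tangles -/

open Classical in
theorem branching_nonempty {ν : ℝ} (hν : 1 < ν) (h : ν ≤ G.mu₁) : G.branching.Nonempty := by
  by_contra hB
  rw [Set.not_nonempty_iff_eq_empty] at hB
  refine h.not_gt ((mu₁_lt_iff (one_pos.trans hν)).2 ⟨fun _ => 1, fun _ => one_pos, fun e => ?_⟩)
  have hcard : (Finset.univ.filter fun e' => G.Follows e e').card ≤ 1 := by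
    refine Finset.card_le_one.2 fun a ha b hb => ?_
    exact (Finset.mem_filter.1 ha).2.eq_of_left (by simp [hB]) (Finset.mem_filter.1 hb).2
  have : ((Finset.univ.filter fun e' => G.Follows e e').card : ℝ) ≤ 1 := by exact_mod_cast hcard
  simp only [Finset.sum_const, nsmul_eq_mul, mul_one]
  linarith

open Classical in
/-- Weights on the edges away from a vertex of degree one extend to its edge `e₀`: a small weight
on `e₀`, which is followed by no edge, and a large one on `inv e₀`, which follows no edge. -/
theorem mu₁_lt_of_degree_eq_one {ν : ℝ} (hν : 1 < ν) {e₀ : G.Edir}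
    (h₀ : ∀ e, G.head e = G.head e₀ → e = e₀) (S : G.Subgraph)
    (hS : ∀ e, e ∈ S.edges ↔ e ≠ e₀ ∧ e ≠ G.inv e₀) (hμ : S.toGraph.mu₁ < ν) : G.mu₁ < ν := by
  have hν0 := one_pos.trans hν
  obtain ⟨x, hx⟩ := (S.mu₁_lt_iff hν0).1 hμ
  obtain ⟨ε, hε, -, hεle⟩ := Finite.exists_pos_le_of_pos (ι := S.edges)
    (fun e => (ν * x e - ∑ e' with e' ∈ S.edges ∧ G.Follows e e', x e') / 2)
    fun e => half_pos (sub_pos.2 (hx e.1 e.2).2)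
  have hsum0 : ∀ e, 0 ≤ ∑ e' with e' ∈ S.edges ∧ G.Follows e e', x e' := fun e =>
    Finset.sum_nonneg fun e' he' => (hx e' (Finset.mem_filter.1 he').2.1).1.le
  let K : ℝ := 1 + ∑ e' with e' ∈ S.edges ∧ G.Follows (G.inv e₀) e', x e'
  let y : G.Edir → ℝ := fun e => if e = e₀ then ε else if e = G.inv e₀ then K else x e
  have hyS : ∀ e ∈ S.edges, y e = x e := fun e he => by
    simp only [y]
    rw [if_neg ((hS e).1 he).1, if_neg ((hS e).1 he).2]
  have hK : 1 ≤ K := by linarith [hsum0 (G.inv e₀)]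
  have hout : ∀ e', ¬ G.Follows e₀ e' := fun e' h => by
    have := h₀ (G.inv e') (by rw [G.head_inv, h.1])
    exact h.2 (by rw [← this, G.inv_inv])
  have hin : ∀ e, ¬ G.Follows e (G.inv e₀) := fun e h => by
    have := h.inv
    rw [G.inv_inv] at this
    exact hout _ this
  refine (mu₁_lt_iff hν0).2 ⟨y, fun e => ?_, fun e => ?_⟩
  · simp only [y]
    split_ifs with h1 h2
    · exact hε
    · linarith
    · exact (hx e ((hS e).2 ⟨h1, h2⟩)).1
  by_cases h1 : e = e₀
  · have : (Finset.univ.filter fun e' => G.Follows e e') = ∅ :=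
      Finset.filter_eq_empty_iff.2 fun e' _ => h1 ▸ hout e'
    rw [this, Finset.sum_empty]
    simp only [y, if_pos h1]
    positivity
  by_cases h2 : e = G.inv e₀
  · have hset : (Finset.univ.filter fun e' => G.Follows e e')
        = Finset.univ.filter fun e' => e' ∈ S.edges ∧ G.Follows e e' := by
      refine Finset.filter_congr fun e' _ => ⟨fun h => ⟨(hS e').2 ⟨?_, ?_⟩, h⟩, fun h => h.2⟩
      · rintro rfl
        exact h.2 (by rw [h2, G.inv_inv])
      · rintro rfl
        exact hin _ h
    rw [hset, Finset.sum_congr rfl fun e' he' => hyS e' (Finset.mem_filter.1 he').2.1]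
    have hye : y e = K := by simp only [y]; rw [if_neg h1, if_pos h2]
    rw [hye, h2]
    have : K ≤ ν * K := le_mul_of_one_le_left (by linarith) hν.le
    linarith
  · have he : e ∈ S.edges := (hS e).2 ⟨h1, h2⟩
    have hsub : (Finset.univ.filter fun e' => G.Follows e e')
        ⊆ insert e₀ (Finset.univ.filter fun e' => e' ∈ S.edges ∧ G.Follows e e') := by
      intro e' he'
      have hf := (Finset.mem_filter.1 he').2
      by_cases h3 : e' = e₀
      · exact Finset.mem_insert.2 (Or.inl h3)
      · refine Finset.mem_insert_of_mem (Finset.mem_filter.2 ⟨Finset.mem_univ _,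
          (hS e').2 ⟨h3, ?_⟩, hf⟩)
        rintro rfl
        exact hin _ hf
    have hy0 : y e₀ = ε := if_pos rfl
    have hn : e₀ ∉ (Finset.univ.filter fun e' => e' ∈ S.edges ∧ G.Follows e e') := fun h =>
      ((hS e₀).1 (Finset.mem_filter.1 h).2.1).1 rfl
    have hle := Finset.sum_le_sum_of_subset_of_nonneg (f := y) hsub fun e' he' _ => by
      rcases Finset.mem_insert.1 he' with rfl | he'
      · rw [hy0]; exact hε.le
      · have := (Finset.mem_filter.1 he').2.1
        rw [hyS e' this]; exact (hx e' this).1.le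
    have hc : ∑ e' with e' ∈ S.edges ∧ G.Follows e e', y e'
        = ∑ e' with e' ∈ S.edges ∧ G.Follows e e', x e' :=
      Finset.sum_congr rfl fun e' he' => hyS e' (Finset.mem_filter.1 he').2.1
    rw [Finset.sum_insert hn, hy0, hc] at hle
    have h4 : ε ≤ (ν * x e - ∑ e' with e' ∈ S.edges ∧ G.Follows e e', x e') / 2 := hεle ⟨e, he⟩
    have h5 := (hx e he).2
    rw [hyS e he]
    linarith

theorem IsMinimalTangle.pruned {ν : ℝ} (hν : 1 < ν) {r : ℤ} (hG : IsMinimalTangle ν r G) :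
    G.Pruned := by
  classical
  intro v
  have hν0 := one_pos.trans hν
  by_contra hv
  have hE : ∃ e₀, G.head e₀ = v := by
    obtain ⟨b, -⟩ := branching_nonempty hν hG.1.2.1
    rcases Relation.ReflTransGen.cases_head (hG.1.1.2 v (G.head b)) with h | ⟨_, ⟨e, he, -⟩, -⟩
    · exact ⟨b, h.symm⟩
    · exact ⟨G.inv e, by rw [G.head_inv, he]⟩
  obtain ⟨e₀, rfl⟩ := hE
  have h₀ : ∀ e, G.head e = G.head e₀ → e = e₀ := by
    intro e he
    rw [degree_eq_card, not_le, Nat.lt_succ_iff, Finset.card_le_one] at hv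
    exact hv e (by simp [he]) e₀ (by simp)
  let S : G.Subgraph :=
    { verts := Set.univ
      edges := {e | e ≠ e₀ ∧ e ≠ G.inv e₀}
      head_mem := fun _ _ => trivial
      inv_mem := fun e he => ⟨fun h => he.2 (by rw [← h, G.inv_inv]),
        fun h => he.1 (by rw [← G.inv_inv e, h, G.inv_inv])⟩ }
  have hS : S.edges ≠ Set.univ := fun h => (h.symm.subset (Set.mem_univ e₀)).1 rfl
  exact hG.1.2.1.not_gt
    (mu₁_lt_of_degree_eq_one hν h₀ S (fun _ => Iff.rfl) (hG.mu₁_lt hν0 S hS))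

theorem IsMinimalTangle.positive {ν : ℝ} (hν : 1 < ν) {r : ℤ} (hG : IsMinimalTangle ν r G) :
    G.Positive := by
  have hP := hG.pruned hν
  refine ⟨hP, fun v => ?_⟩
  have : G.component v = Subgraph.whole G := by
    simp only [component, Subgraph.whole, hG.1.1.2 v]
    rfl
  rw [this, (Subgraph.wholeIso G).ord_eq]
  exact hP.ord_pos (branching_nonempty hν hG.1.2.1)

/-! ### Long chains do not contribute to the Perron–Frobenius eigenvalue -/

open Classical in
theorem card_follows_le {M : ℕ} (hM : G.branching.ncard ≤ M) {e : G.Edir}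
    (he : e ∈ G.branching) : (Finset.univ.filter fun e' => G.Follows e e').card ≤ M := by
  rw [← Set.ncard_coe_finset]
  refine le_trans (Set.ncard_le_ncard_of_injOn G.inv (fun f hf => ?_) (fun a _ b _ h => ?_)) hM
  · exact (inv_mem_branching_iff (Finset.mem_filter.1 (Finset.mem_coe.1 hf)).2).2 he
  · rw [← G.inv_inv a, h, G.inv_inv]

open Classical in
/-- Subinvariant weights on a subgraph `S` extend to chains outside `S` if those are long enough:
the first edge of such a chain gets a weight `δ` within the slack of the inequalities on `S`, and
the weights increase along the chain by a factor `c` with `1 < c < ν`, so that the weight of the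
last edge of the chain exceeds the total weight of the edges that follow it. -/
theorem exists_mu₁_lt_of_long_chains {ν : ℝ} (hν : 1 < ν) (M N : ℕ) : ∃ n : ℕ,
    ∀ G : FinGraph.{u}, G.Connected → G.Pruned → G.branching.Nonempty → G.branching.ncard ≤ M →
      ∀ S : G.Subgraph, S.edges.ncard ≤ N → S.toGraph.mu₁ < ν →
      (∀ e e', e ∉ G.branching → G.Follows e e' → (e ∈ S.edges ↔ e' ∈ S.edges)) →
      (∀ e, e ∉ S.edges → n ≤ G.chainLength e) → G.mu₁ < ν := by
  have hν0 := one_pos.trans hν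
  obtain ⟨m, hm, hm1, hslack⟩ := exists_uniform_slack.{u} ν N
  set δ : ℝ := m / (M + 1) with hδ
  have hδ0 : 0 < δ := by positivity
  have hMδ : M * δ < m := by
    have : (M + 1) * δ = m := by rw [hδ]; field_simp
    linarith
  have hδ1 : δ ≤ 1 := (div_le_self hm.le (by linarith [Nat.cast_nonneg (α := ℝ) M])).trans hm1
  set c : ℝ := (1 + ν) / 2 with hc
  have hc1 : 1 < c := by linarith
  have hcν : c < ν := by linarith
  obtain ⟨k, hk⟩ := pow_unbounded_of_one_lt (M / δ) hc1
  rw [div_lt_iff₀ hδ0] at hk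
  refine ⟨k + 1, fun G hG hP hB hM S hS hμ hsat hlong => ?_⟩
  obtain ⟨x, hx⟩ := hslack S.toGraph.Edir S.toGraph.Follows
    (by rw [← Nat.card_eq_fintype_card]; exact hS) ((mu₁_lt_iff hν0).1 hμ)
  let y : G.Edir → ℝ := fun e =>
    if h : e ∈ S.edges then x ⟨e, h⟩ else δ * c ^ G.toBranch (G.inv e)
  have hyS : ∀ e : S.toGraph.Edir, y e.1 = x e := fun e => dif_pos e.2
  have hyn : ∀ e, e ∉ S.edges → y e = δ * c ^ G.toBranch (G.inv e) := fun e he => dif_neg he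
  have hpos : ∀ e, 0 < y e := fun e => by
    by_cases he : e ∈ S.edges
    · rw [hyS ⟨e, he⟩]; exact hm.trans_le (hx _).1
    · rw [hyn e he]; positivity
  have hstart : ∀ e f, e ∈ G.branching → G.Follows e f → f ∉ S.edges → y f = δ :=
    fun e f he hf hfS => by
      rw [hyn f hfS, toBranch_eq_zero ((inv_mem_branching_iff hf).2 he), pow_zero, mul_one]
  have hcard : ∀ e ∈ G.branching,
      ((Finset.univ.filter fun e' => G.Follows e e').card : ℝ) ≤ M := fun e he => by
    exact_mod_cast card_follows_le hM he
  refine (mu₁_lt_iff hν0).2 ⟨y, hpos, fun e => ?_⟩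
  by_cases heS : e ∈ S.edges
  · have hrest : ∑ f with G.Follows e f ∧ f ∉ S.edges, y f ≤ M * δ := by
      by_cases he : e ∈ G.branching
      · rw [Finset.sum_congr rfl fun f hf =>
          hstart e f he (Finset.mem_filter.1 hf).2.1 (Finset.mem_filter.1 hf).2.2,
          Finset.sum_const, nsmul_eq_mul]
        refine mul_le_mul_of_nonneg_right (le_trans ?_ (hcard e he)) hδ0.le
        exact_mod_cast Finset.card_le_card
          (Finset.monotone_filter_right _ fun f _ (h : _ ∧ _) => h.1)
      · rw [Finset.filter_eq_empty_iff.2 fun f _ h => h.2 ((hsat e f he h.1).1 heS),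
          Finset.sum_empty]
        positivity
    have hmain := (hx ⟨e, heS⟩).2.2
    have hsum : ∑ f with f ∈ S.edges ∧ G.Follows e f, y f
        = ∑ f with S.toGraph.Follows ⟨e, heS⟩ f, x f :=
      (S.sum_follows y ⟨e, heS⟩).symm.trans (Finset.sum_congr rfl fun f _ => hyS f)
    rw [← hsum, ← hyS ⟨e, heS⟩] at hmain
    have hsplit := Finset.sum_filter_add_sum_filter_not
      (Finset.univ.filter fun f => G.Follows e f) (fun f => f ∈ S.edges) y
    rw [Finset.filter_filter, Finset.filter_filter] at hsplit
    simp only [and_comm (b := _ ∈ S.edges)] at hsplit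
    linarith
  by_cases he : e ∈ G.branching
  · have h1 : ∀ f ∈ Finset.univ.filter fun f => G.Follows e f, y f ≤ 1 := fun f hf => by
      by_cases hfS : f ∈ S.edges
      · rw [hyS ⟨f, hfS⟩]; exact (hx _).2.1
      · rw [hstart e f he (Finset.mem_filter.1 hf).2 hfS]; exact hδ1
    have h2 := Finset.sum_le_card_nsmul _ _ _ h1
    rw [nsmul_eq_mul, mul_one] at h2
    have h3 : k ≤ G.toBranch (G.inv e) := by
      have := hlong e heS
      rw [chainLength, toBranch_eq_zero he] at this
      lia
    have h4 : c ^ k * δ ≤ y e := by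
      rw [hyn e heS, mul_comm]
      exact mul_le_mul_of_nonneg_left (pow_le_pow_right₀ hc1.le h3) hδ0.le
    have h5 : y e ≤ ν * y e := le_mul_of_one_le_left (hpos e).le hν.le
    linarith [hcard e he]
  · have hset : (Finset.univ.filter fun f => G.Follows e f) = {G.next e} := by
      ext f
      simp only [Finset.mem_filter, Finset.mem_univ, true_and, Finset.mem_singleton]
      exact ⟨fun h => h.eq_of_left he (hP.follows_next e), fun h => h ▸ hP.follows_next e⟩
    have hf := hP.follows_next e
    rw [hset, Finset.sum_singleton, hyn _ fun h => heS ((hsat e _ he hf).2 h),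
      toBranch_inv_eq_succ hG hP hB he hf, pow_succ, ← mul_assoc, ← hyn e heS, mul_comm]
    exact mul_lt_mul_of_pos_right hcν (hpos e)

/-! ### Minimal tangles have bounded size -/

theorem exists_interval_disjoint_range {α : Type*} [Finite α] (f : α → ℕ) {M : ℕ}
    (hf : (Set.range f).ncard ≤ M) {L : ℕ → ℕ} (hL : Monotone L) :
    ∃ j ≤ M, ∀ a, L j ≤ f a → L (j + 1) ≤ f a := by
  by_contra hcon
  push Not at hcon
  have hcon' : ∀ j : Fin (M + 1), ∃ a, L j ≤ f a ∧ f a < L (j + 1) := fun j =>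
    hcon j (Nat.lt_succ_iff.1 j.2)
  choose a ha ha' using hcon'
  have hlt : ∀ i j : Fin (M + 1), i < j → f (a i) < f (a j) := fun i j hij =>
    (ha' i).trans_le ((hL (Nat.succ_le_of_lt hij)).trans (ha j))
  have hinj : Function.Injective fun j => (⟨f (a j), a j, rfl⟩ : Set.range f) :=
    (StrictMono.injective (f := fun j => f (a j)) fun i j => hlt i j).of_comp
      (f := Subtype.val)
  have := Nat.card_le_card_of_injective _ hinj
  rw [Nat.card_fin, Nat.card_coe_set_eq] at this
  lia

/-- Consider thresholds `L 0 < L 1 < …` that grow so fast that chains of length at least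
`L (j + 1)` are negligible in comparison with the graph formed by the chains shorter than `L j`.
A minimal tangle has a bounded number `M` of chains, so some interval `[L j, L (j + 1))` contains
none of their lengths; by minimality all chains are then shorter than `L j`. -/
theorem exists_card_edir_le {ν : ℝ} (hν : 1 < ν) (r : ℤ) : ∃ K : ℕ, ∀ G : FinGraph.{u},
    IsMinimalTangle ν r G → Nat.card G.Edir ≤ K := by
  set M := (6 * r).toNat
  choose F hF using exists_mu₁_lt_of_long_chains.{u} hν M
  let L : ℕ → ℕ := fun j => Nat.rec 1 (fun _ l => max l (F (M * l))) j
  have hL : Monotone L := monotone_nat_of_le_succ fun j => le_max_left _ _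
  refine ⟨M * L M, fun G hT => ?_⟩
  have hG := hT.1.1
  have hP := hT.pruned hν
  have hB := branching_nonempty hν hT.1.2.1
  have hM : G.branching.ncard ≤ M := by
    have h1 := hP.ncard_branching_le
    have h2 := hT.1.2.2
    lia
  obtain ⟨j, hj, hgap⟩ := exists_interval_disjoint_range G.chainLength
    ((ncard_range_chainLength_le hG hP hB).trans hM) hL
  have hcard : {e | G.chainLength e < L j}.ncard ≤ M * L j :=
    (ncard_chainLength_lt_le hG hP hB (L j)).trans (Nat.mul_le_mul_right _ hM)
  let S : G.Subgraph :=
    { verts := Set.univ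
      edges := {e | G.chainLength e < L j}
      head_mem := fun _ _ => trivial
      inv_mem := fun e he => (chainLength_inv e).trans_lt he }
  by_cases hS : S.edges = Set.univ
  · have h1 : Nat.card G.Edir ≤ M * L j := by
      rw [← Set.ncard_univ, ← hS]
      exact hcard
    exact h1.trans (Nat.mul_le_mul_left _ (hL hj))
  · refine absurd hT.1.2.1 (not_le.2 (hF (M * L j) G hG hP hB hM S hcard
      (hT.mu₁_lt (one_pos.trans hν) S hS) (fun e e' he h => ?_) fun e he => ?_))
    · change G.chainLength e < L j ↔ G.chainLength e' < L j
      rw [chainLength_eq hG hP hB he h]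
    · exact (le_max_right (L j) (F (M * L j))).trans (hgap e (not_lt.1 he))

/-- Graphs of bounded size fall into finitely many isomorphism classes, being determined up to
isomorphism by the structure maps on standard finite sets. -/
theorem finite_isoClass (K : ℕ) (P : FinGraph.{u} → Prop)
    (hP : ∀ G, P G → Nat.card G.V ≤ K ∧ Nat.card G.Edir ≤ K) :
    {c : IsoClass.{u} | ∃ G, P G ∧ Quotient.mk isoSetoid G = c}.Finite := by
  let Code : Type := Σ p : Fin (K + 1) × Fin (K + 1),
    (Fin p.1 → Fin p.2) × (Fin p.1 → Fin p.2) × (Fin p.1 → Fin p.1)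
  have hcode : ∀ c : {c : IsoClass.{u} | ∃ G, P G ∧ Quotient.mk isoSetoid G = c}, ∃ x : Code,
      ∃ G : FinGraph.{u}, Quotient.mk isoSetoid G = c.1 ∧
      ∃ (a : G.Edir ≃ Fin x.1.1) (b : G.V ≃ Fin x.1.2), x.2.1 = b ∘ G.head ∘ a.symm ∧
        x.2.2.1 = b ∘ G.tail ∘ a.symm ∧ x.2.2.2 = a ∘ G.inv ∘ a.symm := by
    rintro ⟨c, G, hG, rfl⟩
    obtain ⟨h1, h2⟩ := hP G hG
    let a := Finite.equivFin G.Edir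
    let b := Finite.equivFin G.V
    exact ⟨⟨(⟨_, Nat.lt_succ_of_le h2⟩, ⟨_, Nat.lt_succ_of_le h1⟩),
      b ∘ G.head ∘ a.symm, b ∘ G.tail ∘ a.symm, a ∘ G.inv ∘ a.symm⟩, G, rfl, a, b, rfl, rfl, rfl⟩
  choose code hcode using hcode
  suffices Finite {c : IsoClass.{u} | ∃ G, P G ∧ Quotient.mk isoSetoid G = c} from Set.toFinite _
  refine Finite.of_injective code fun c c' h => Subtype.ext ?_
  obtain ⟨G, hG, a, b, h1, h2, h3⟩ := hcode c
  have hc' := hcode c'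
  rw [← h] at hc'
  obtain ⟨G', hG', a', b', h1', h2', h3'⟩ := hc'
  rw [← hG, ← hG']
  refine Quotient.sound ⟨⟨b.trans b'.symm, a.trans a'.symm, fun e => ?_, fun e => ?_, fun e => ?_⟩⟩
  · have := congrFun (h1.symm.trans h1') (a e)
    simp only [Function.comp_apply, Equiv.symm_apply_apply] at this
    simp [this]
  · have := congrFun (h2.symm.trans h2') (a e)
    simp only [Function.comp_apply, Equiv.symm_apply_apply] at this
    simp [this]
  · have := congrFun (h3.symm.trans h3') (a e)
    simp only [Function.comp_apply, Equiv.symm_apply_apply] at this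
    simp [this]

theorem finite_isoClass_isMinimalTangle {ν : ℝ} (hν : 1 < ν) (r : ℤ) : {c : IsoClass.{u} |
    ∃ ψ : FinGraph.{u}, IsMinimalTangle ν r ψ ∧ Quotient.mk isoSetoid ψ = c}.Finite := by
  obtain ⟨K, hK⟩ := exists_card_edir_le.{u} hν r
  refine finite_isoClass K _ fun G hG => ⟨?_, hK G hG⟩
  have := (hG.pruned hν).two_mul_card_le
  have := hK G hG
  lia

/-! ### Generation of the tangles by finitely many positive graphs -/

theorem meets_hasTangles {ν : ℝ} (hν : 0 < ν) (r : ℤ) :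
    Meets (HasTangles.{u} ν r) = HasTangles ν r := by
  ext G
  constructor
  · rintro ⟨S, -, ψ, ⟨U, hU⟩, ⟨f⟩⟩
    -- The tangle `U` in `ψ` is carried to a subgraph of `S` by the inverse of `f`.
    let U' : S.toGraph.Subgraph :=
      { verts := f.onV ⁻¹' U.verts
        edges := f.onE ⁻¹' U.edges
        head_mem := fun e he => by
          rw [Set.mem_preimage, ← f.map_head]; exact U.head_mem _ he
        inv_mem := fun e he => by
          rw [Set.mem_preimage, ← f.map_inv]; exact U.inv_mem _ he }
    let g : Iso U'.toGraph U.toGraph :=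
      { onV := f.onV.subtypeEquiv fun _ => Iff.rfl
        onE := f.onE.subtypeEquiv fun _ => Iff.rfl
        map_head := fun e => Subtype.ext (f.map_head e.1)
        map_tail := fun e => Subtype.ext (f.map_tail e.1)
        map_inv := fun e => Subtype.ext (f.map_inv e.1) }
    exact ⟨S.lift U', (S.liftIso U').isTangle hν (g.symm.isTangle hν hU)⟩
  · rintro ⟨S, hS⟩
    obtain ⟨v⟩ := hS.1.1
    exact ⟨S, ⟨v.1, v.2⟩, S.toGraph,
      ⟨Subgraph.whole _, (Subgraph.wholeIso _).symm.isTangle hν hS⟩, Setoid.refl S.toGraph⟩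

theorem exists_hasTangles_eq_meets {ν : ℝ} (hν : 1 < ν) (r : ℤ) : ∃ T : Set FinGraph.{u},
    T.Finite ∧ (∀ ψ ∈ T, ψ.Positive) ∧ HasTangles ν r = Meets T := by
  have hν0 := one_pos.trans hν
  have hfin := finite_isoClass_isMinimalTangle.{u} hν r
  have := hfin.to_subtype
  choose ψ hψ hψc using fun c : {c : IsoClass.{u} |
    ∃ ψ : FinGraph.{u}, IsMinimalTangle ν r ψ ∧ Quotient.mk isoSetoid ψ = c} => c.2
  refine ⟨Set.range ψ, Set.finite_range ψ, ?_, ?_⟩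
  · rintro _ ⟨c, rfl⟩
    exact (hψ c).positive hν
  ext G
  constructor
  · rintro ⟨S, hS⟩
    obtain ⟨U, hU⟩ := exists_isMinimalTangle hν0 S hS
    obtain ⟨v⟩ := hU.1.1.1
    exact ⟨U, ⟨v.1, v.2⟩, _, ⟨⟨_, U.toGraph, hU, rfl⟩, rfl⟩,
      Quotient.exact (hψc ⟨_, U.toGraph, hU, rfl⟩).symm⟩
  · rintro ⟨S, -, _, ⟨c, rfl⟩, ⟨f⟩⟩
    exact ⟨S, f.symm.isTangle hν0 (hψ c).1⟩

end FinGraph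

theorem mainTheorem6 (ν : ℝ) (hν : 1 < ν) (r : ℤ) :
    {c : FinGraph.IsoClass.{u} |
        ∃ ψ : FinGraph.{u}, FinGraph.IsMinimalTangle ν r ψ ∧ Quotient.mk FinGraph.isoSetoid ψ = c}.Finite ∧
      FinGraph.FinitelyPositivelyGenerated (FinGraph.HasTangles.{u} ν r) ∧
      ∃ T' : Set FinGraph.{u}, T'.Finite ∧ (∀ ψ ∈ T', ψ.Positive) ∧
        FinGraph.TangleFree ν r = FinGraph.Avoids T' := by
  obtain ⟨T, hT, hpos, hmeets⟩ := FinGraph.exists_hasTangles_eq_meets.{u} hν r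
  refine ⟨FinGraph.finite_isoClass_isMinimalTangle hν r,
    ⟨T, hT, hpos, (FinGraph.meets_hasTangles (one_pos.trans hν) r).trans hmeets⟩,
    T, hT, hpos, ?_⟩
  rw [FinGraph.Avoids, ← hmeets]
  ext G
  exact not_exists.symm
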